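/- Notation. For formal power series $\alpha=\sum_n\alpha_nx^n$ and $\beta=\sum_n\beta_nx^n$ in $\mathbb C[[x]]$, let $u_\alpha$ and $d_\beta$ be the infinite lower triangular matrices indexed by $i,j\in\mathbb N=\{0,1,2,\dots\}$ with entries $(u_\alpha)_{i,j}=\alpha_{i-j}$ and $(d_\beta)_{i,j}=j\,\beta_{i-j}$ for $j\le i$, and $0$ for $j>i$. The matrix exponential $M=\exp(u_\alpha+d_\beta)=\sum_{n\ge0}(u_\alpha+d_\beta)^n/n!$ converges entrywise, and $\mathrm{Exp}(\alpha;\beta)=\sum_{n\ge0}M_{n,0}\,x^n\in\mathbb C[[x]]$ denotes the generating series of its column of index $0$. Theorem. Let $\mathcal O\subset\mathbb C$ be a connected (not necessarily simply connected) open set containing $0$, and let $\alpha,\beta$ be holomorphic functions on $\mathcal O$, identified with their Taylor series at $0$ whenever they appear in $\mathrm{Exp}$. Then there are a connected open set $\mathcal V\subset\mathbb C^2$ containing $\mathcal O\times\{0\}$ and $\{0\}\times\mathbb C$, and a holomorphic function $F:\mathcal V\to\mathbb C$, such that: (a) $F(x,s)=\mathrm{Exp}(s\alpha;s\beta)(x)$,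 in the sense that for every $s\in\mathbb C$ the formal power series $\mathrm{Exp}(s\alpha;s\beta)\in\mathbb C[[x]]$ has positive radius of convergence and its sum is $F(x,s)$ for all $x$ sufficiently close to $0$ (so $F$ is the unique analytic continuation of $\mathrm{Exp}(s\alpha;s\beta)$ to $\mathcal V$); (b) for every $\xi\in\mathcal O$, the power series expansion of $F$ at the point $(\xi,0)$ is $$F(x+\xi,s)=\sum_{n=0}^\infty G_n(x)\,\frac{s^n}{n!},$$ where $G_0=1$, $G_{n+1}=\alpha(x+\xi)\,G_n+(x+\xi)\,\beta(x+\xi)\,G_n'$ in $\mathbb C[[x]]$, with $\alpha(x+\xi),\beta(x+\xi)$ denoting the Taylor series of $\alpha,\beta$ at $\xi$; more precisely, there is $r>0$ such that for $|x|<r$ and $|s|<r$ the double series in $x,s$ obtained by writing out the $G_n$ converges absolutely with sum $F(x+\xi,s)$. -/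

import Mathlib

open Finset

noncomputable section

namespace InterpolationGroup

/-- The infinite lower triangular matrix `u_α`, with entries `α_{i-j}` for `j ≤ i`. -/
def uMatrix (α : PowerSeries ℂ) : Matrix ℕ ℕ ℂ :=
  fun i j => if j ≤ i then PowerSeries.coeff (i - j) α else 0

/-- The infinite lower triangular matrix `d_β`, with entries `j * β_{i-j}` for `j ≤ i`. -/
def dMatrix (β : PowerSeries ℂ) : Matrix ℕ ℕ ℂ :=
  fun i j => if j ≤ i then (j : ℂ) * PowerSeries.coeff (i - j) β else 0

/-- The matrix product `A B` for a lower triangular matrix `A`: row `i` of `A` is supported on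
the columns `0, …, i`, so the usual sum over `k` is this finite sum. -/
def triMul (A B : Matrix ℕ ℕ ℂ) : Matrix ℕ ℕ ℂ :=
  fun i j => ∑ k ∈ range (i + 1), A i k * B k j

/-- The powers of a lower triangular infinite matrix. -/
def triPow (M : Matrix ℕ ℕ ℂ) : ℕ → Matrix ℕ ℕ ℂ
  | 0 => 1
  | n + 1 => triMul M (triPow M n)

/-- The exponential `∑ Mⁿ / n!` of a lower triangular infinite matrix, entry by entry. Every
one of these series converges: see `summable_triExp`. -/
def triExp (M : Matrix ℕ ℕ ℂ) : Matrix ℕ ℕ ℂ :=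
  fun i j => ∑' n : ℕ, triPow M n i j / (n.factorial : ℂ)

theorem norm_triPow_le (M : Matrix ℕ ℕ ℂ) (N n : ℕ) {i : ℕ} (hi : i ≤ N) (j : ℕ) :
    ‖triPow M n i j‖ ≤ (∑ k ∈ range (N + 1), ∑ l ∈ range (N + 1), ‖M k l‖) ^ n := by
  induction n generalizing i with
  | zero =>
    simp only [triPow, pow_zero, Matrix.one_apply]
    split_ifs <;> simp
  | succ n ih =>
    set S := ∑ k ∈ range (N + 1), ∑ l ∈ range (N + 1), ‖M k l‖ with hS
    have hS0 : 0 ≤ S := sum_nonneg fun k _ => sum_nonneg fun l _ => norm_nonneg _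
    have h1 : ‖triPow M (n + 1) i j‖ ≤ ∑ k ∈ range (i + 1), ‖M i k‖ * S ^ n := by
      refine (norm_sum_le (range (i + 1)) fun k => M i k * triPow M n k j).trans
        (sum_le_sum fun k hk => ?_)
      rw [norm_mul]
      have hk' := mem_range.1 hk
      exact mul_le_mul_of_nonneg_left (ih (by omega)) (norm_nonneg _)
    have h2 : ∑ k ∈ range (i + 1), ‖M i k‖ ≤ ∑ l ∈ range (N + 1), ‖M i l‖ :=
      sum_le_sum_of_subset_of_nonneg (range_mono (by omega)) fun _ _ _ => norm_nonneg _
    have h3 : ∑ l ∈ range (N + 1), ‖M i l‖ ≤ S :=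
      single_le_sum (f := fun k => ∑ l ∈ range (N + 1), ‖M k l‖)
        (fun k _ => sum_nonneg fun l _ => norm_nonneg _) (mem_range.2 (by omega))
    rw [← sum_mul] at h1
    rw [pow_succ']
    exact h1.trans (mul_le_mul_of_nonneg_right (h2.trans h3) (pow_nonneg hS0 n))

/-- The series that defines an entry of the exponential converges (absolutely). -/
theorem summable_triExp (M : Matrix ℕ ℕ ℂ) (i j : ℕ) :
    Summable fun n : ℕ => triPow M n i j / (n.factorial : ℂ) := by
  refine Summable.of_norm_bounded (Real.summable_pow_div_factorial
    (∑ k ∈ range (i + 1), ∑ l ∈ range (i + 1), ‖M k l‖)) fun n => ?_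
  rw [norm_div, Complex.norm_natCast]
  exact div_le_div_of_nonneg_right (norm_triPow_le M i n le_rfl j) (Nat.cast_nonneg _)

/-- `Exp(α; β)`: the generating series of column `0` of the matrix `exp (u_α + d_β)`. -/
def Exp (α β : PowerSeries ℂ) : PowerSeries ℂ :=
  PowerSeries.mk fun i => triExp (uMatrix α + dMatrix β) i 0

/-- The Taylor series at `ξ` of a function, as a formal power series `f ∘ (x + ξ)` in `x`. -/
def taylorAt (f : ℂ → ℂ) (ξ : ℂ) : PowerSeries ℂ :=
  PowerSeries.mk fun k => iteratedDeriv k f ξ / (k.factorial : ℂ)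

/-- The series `G_n` at the point `ξ`: `G_0 = 1` and
`G_{n+1} = {α ∘ (x + ξ)} G_n + (x + ξ) {β ∘ (x + ξ)} G_n'`. -/
def localCoeff (α β : ℂ → ℂ) (ξ : ℂ) : ℕ → PowerSeries ℂ
  | 0 => 1
  | n + 1 => taylorAt α ξ * localCoeff α β ξ n +
      (PowerSeries.X + PowerSeries.C ξ) * taylorAt β ξ *
        PowerSeries.derivative ℂ (localCoeff α β ξ n)

end InterpolationGroup

end

namespace InterpolationGroup

open Metric

/-- The iterates `D^n 1` of the differential operator `D f = α f + x β f'`. -/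
noncomputable def iterCoeff (α β : ℂ → ℂ) : ℕ → ℂ → ℂ
  | 0 => fun _ => 1
  | n + 1 => fun x => α x * iterCoeff α β n x + x * β x * deriv (iterCoeff α β n) x

theorem differentiableOn_iterCoeff {O : Set ℂ} (hO : IsOpen O) {α β : ℂ → ℂ}
    (hα : DifferentiableOn ℂ α O) (hβ : DifferentiableOn ℂ β O) (n : ℕ) :
    DifferentiableOn ℂ (iterCoeff α β n) O := by
  induction n with
  | zero => exact differentiableOn_const _
  | succ n ih =>
    exact (hα.mul ih).add ((differentiableOn_id.mul hβ).mul (ih.deriv hO))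

theorem taylorAt_add {f g : ℂ → ℂ} {ξ : ℂ} (hf : AnalyticAt ℂ f ξ) (hg : AnalyticAt ℂ g ξ) :
    taylorAt (fun x => f x + g x) ξ = taylorAt f ξ + taylorAt g ξ := by
  ext k
  simp only [taylorAt, PowerSeries.coeff_mk, map_add]
  rw [iteratedDeriv_fun_add hf.contDiffAt hg.contDiffAt, add_div]

theorem taylorAt_mul {f g : ℂ → ℂ} {ξ : ℂ} (hf : AnalyticAt ℂ f ξ) (hg : AnalyticAt ℂ g ξ) :
    taylorAt (fun x => f x * g x) ξ = taylorAt f ξ * taylorAt g ξ := by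
  ext k
  rw [PowerSeries.coeff_mul, Finset.Nat.sum_antidiagonal_eq_sum_range_succ_mk]
  simp only [taylorAt, PowerSeries.coeff_mk]
  rw [iteratedDeriv_fun_mul hf.contDiffAt hg.contDiffAt, Finset.sum_div]
  refine Finset.sum_congr rfl fun i hi => ?_
  rw [Nat.cast_choose _ (Nat.lt_succ_iff.1 (mem_range.1 hi))]
  field_simp [Nat.factorial_ne_zero]

theorem taylorAt_deriv (f : ℂ → ℂ) (ξ : ℂ) :
    taylorAt (deriv f) ξ = PowerSeries.derivative ℂ (taylorAt f ξ) := by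
  ext k
  rw [PowerSeries.coeff_derivative]
  simp only [taylorAt, PowerSeries.coeff_mk]
  rw [← iteratedDeriv_succ', Nat.factorial_succ]
  have : (k : ℂ) + 1 ≠ 0 := by exact_mod_cast k.succ_ne_zero
  push_cast
  field_simp [Nat.factorial_ne_zero]

theorem taylorAt_one (ξ : ℂ) : taylorAt (fun _ => 1) ξ = 1 := by
  ext k
  rw [PowerSeries.coeff_one]
  simp only [taylorAt, PowerSeries.coeff_mk, iteratedDeriv_const]
  split_ifs with h <;> simp [h]

theorem taylorAt_id (ξ : ℂ) : taylorAt (fun x => x) ξ = PowerSeries.X + PowerSeries.C ξ := by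
  ext k
  rw [map_add, PowerSeries.coeff_X, PowerSeries.coeff_C]
  simp only [taylorAt, PowerSeries.coeff_mk]
  rcases k with _ | _ | k
  · simp
  · simp [iteratedDeriv_one]
  · rw [iteratedDeriv_succ', iteratedDeriv_succ']
    simp

theorem taylorAt_iterCoeff {O : Set ℂ} (hO : IsOpen O) {α β : ℂ → ℂ}
    (hα : DifferentiableOn ℂ α O) (hβ : DifferentiableOn ℂ β O) {ξ : ℂ} (hξ : ξ ∈ O) (n : ℕ) :
    taylorAt (iterCoeff α β n) ξ = localCoeff α β ξ n := by
  have han : ∀ {f : ℂ → ℂ}, DifferentiableOn ℂ f O → AnalyticAt ℂ f ξ :=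
    fun hf => hf.analyticAt (hO.mem_nhds hξ)
  induction n with
  | zero => exact taylorAt_one ξ
  | succ n ih =>
    have hg := differentiableOn_iterCoeff hO hα hβ n
    have hid : AnalyticAt ℂ (fun x : ℂ => x) ξ := analyticAt_id
    change taylorAt (fun x => α x * iterCoeff α β n x + x * β x * deriv (iterCoeff α β n) x) ξ = _
    rw [taylorAt_add (f := fun x => α x * iterCoeff α β n x)
        (g := fun x => x * β x * deriv (iterCoeff α β n) x) ((han hα).mul (han hg))
        ((hid.mul (han hβ)).mul (han hg).deriv),
      taylorAt_mul (han hα) (han hg),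
      taylorAt_mul (f := fun x => x * β x) (hid.mul (han hβ)) (han hg).deriv,
      taylorAt_mul hid (han hβ), taylorAt_deriv, taylorAt_id, ih]
    rfl

/-- Column `0` of the powers of `u_{sα} + d_{sβ}` in terms of `D f = α f + x β f'`. -/
theorem triPow_smul_eq_coeff_localCoeff (α β : ℂ → ℂ) (s : ℂ) (n i : ℕ) :
    triPow (uMatrix (s • taylorAt α 0) + dMatrix (s • taylorAt β 0)) n i 0 =
      s ^ n * PowerSeries.coeff i (localCoeff α β 0 n) := by
  induction n generalizing i with
  | zero =>
    simp only [triPow, localCoeff, pow_zero, one_mul, PowerSeries.coeff_one, Matrix.one_apply]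
  | succ n ih =>
    have hX : PowerSeries.X * taylorAt β 0 * PowerSeries.derivative ℂ (localCoeff α β 0 n) =
        taylorAt β 0 * (PowerSeries.X * PowerSeries.derivative ℂ (localCoeff α β 0 n)) := by ring
    have hXd : ∀ k, PowerSeries.coeff k
        (PowerSeries.X * PowerSeries.derivative ℂ (localCoeff α β 0 n)) =
          (k : ℂ) * PowerSeries.coeff k (localCoeff α β 0 n) := by
      rintro (_ | k)
      · simp
      · rw [PowerSeries.coeff_succ_X_mul, PowerSeries.coeff_derivative]
        push_cast
        ring
    simp only [triPow, localCoeff, triMul, map_zero, add_zero]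
    rw [hX, map_add, mul_comm (taylorAt α 0), mul_comm (taylorAt β 0), PowerSeries.coeff_mul,
      PowerSeries.coeff_mul, Finset.Nat.sum_antidiagonal_eq_sum_range_succ_mk,
      Finset.Nat.sum_antidiagonal_eq_sum_range_succ_mk, ← Finset.sum_add_distrib, Finset.mul_sum]
    refine Finset.sum_congr rfl fun k hk => ?_
    have hki : k ≤ i := Nat.lt_succ_iff.1 (mem_range.1 hk)
    rw [ih, hXd]
    simp only [Matrix.add_apply, uMatrix, dMatrix, hki, if_true, PowerSeries.coeff_smul,
      smul_eq_mul]
    ring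

theorem coeff_Exp_smul (α β : ℂ → ℂ) (s : ℂ) (i : ℕ) :
    PowerSeries.coeff i (Exp (s • taylorAt α 0) (s • taylorAt β 0)) =
      ∑' n : ℕ, PowerSeries.coeff i (localCoeff α β 0 n) * (s ^ n / (n.factorial : ℂ)) := by
  simp only [Exp, PowerSeries.coeff_mk, triExp]
  refine tsum_congr fun n => ?_
  rw [triPow_smul_eq_coeff_localCoeff]
  ring

theorem norm_deriv_le_of_closedBall {f : ℂ → ℂ} {x : ℂ} {d M : ℝ} (hd : 0 < d)
    (hf : DifferentiableOn ℂ f (closedBall x d)) (hM : ∀ z ∈ closedBall x d, ‖f z‖ ≤ M) :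
    ‖deriv f x‖ ≤ M / d :=
  Complex.norm_deriv_le_of_forall_mem_sphere_norm_le hd (hf.diffContOnCl_ball subset_rfl)
    fun z hz => hM z (sphere_subset_closedBall hz)

/-- If each step on nested sets costs `A + B / h` when the parameter moves by `h`, then `n` equal
steps give `(A + B n / H)^n`. -/
theorem norm_le_pow_of_nested {g : ℕ → ℂ → ℂ} {K : ℝ → Set ℂ} {A B H : ℝ} (hH : 0 < H)
    (hg0 : ∀ x, ‖g 0 x‖ ≤ 1)
    (step : ∀ n t h M, 0 ≤ t → 0 < h → t + h ≤ H → (∀ x ∈ K t, ‖g n x‖ ≤ M) →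
      ∀ x ∈ K (t + h), ‖g (n + 1) x‖ ≤ (A + B / h) * M) (n : ℕ) :
    ∀ x ∈ K H, ‖g n x‖ ≤ (A + B * n / H) ^ n := by
  rcases n.eq_zero_or_pos with rfl | hn
  · intro x _
    simpa using hg0 x
  have hn' : (0 : ℝ) < n := by exact_mod_cast hn
  have key : ∀ m : ℕ, m ≤ n → ∀ x ∈ K (m * (H / n)), ‖g m x‖ ≤ (A + B * n / H) ^ m := by
    intro m
    induction m with
    | zero =>
      intro _ x _
      simpa using hg0 x
    | succ m ih =>
      intro hm x hx
      have h1 : ((m + 1 : ℕ) : ℝ) * (H / n) = m * (H / n) + H / n := by push_cast; ring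
      have h2 : ((m + 1 : ℕ) : ℝ) * (H / n) ≤ H := by
        rw [mul_div_assoc', div_le_iff₀ hn', mul_comm]
        exact mul_le_mul_of_nonneg_left (by exact_mod_cast hm) hH.le
      rw [h1] at hx h2
      have := step m (m * (H / n)) (H / n) _ (by positivity) (by positivity) h2
        (ih (by omega)) x hx
      rwa [show B / (H / n) = B * n / H by field_simp, ← pow_succ'] at this
  have := key n le_rfl
  rwa [show (n : ℝ) * (H / n) = H by field_simp] at this

theorem add_mul_div_pow_le {A B H : ℝ} (hA : 0 ≤ A) (hB : 0 < B) (hH : 0 < H) (n : ℕ) :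
    (A + B * n / H) ^ n ≤
      Real.exp (A * H / B) * (n.factorial : ℝ) / (H / (B * Real.exp 1)) ^ n := by
  rcases n.eq_zero_or_pos with rfl | hn
  · simpa using Real.one_le_exp (by positivity : 0 ≤ A * H / B)
  have hn' : (0 : ℝ) < n := by exact_mod_cast hn
  have h1 : A + B * n / H = (B / H) * n * (A * H / B / n + 1) := by field_simp
  have h2 : (A * H / B / n + 1) ^ n ≤ Real.exp (A * H / B) := by
    calc (A * H / B / n + 1) ^ n ≤ (Real.exp (A * H / B / n)) ^ n :=
          pow_le_pow_left₀ (by positivity) (Real.add_one_le_exp _) n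
      _ = Real.exp (A * H / B) := by
          rw [← Real.exp_nat_mul]; congr 1; field_simp
  have h3 : (n : ℝ) ^ n ≤ Real.exp 1 ^ n * n.factorial := by
    have := Real.pow_div_factorial_le_exp (x := (n : ℝ)) hn'.le n
    rw [div_le_iff₀ (by positivity)] at this
    rwa [← Real.exp_nat_mul, mul_one]
  calc (A + B * n / H) ^ n = (B / H) ^ n * ((n : ℝ) ^ n * (A * H / B / n + 1) ^ n) := by
        rw [h1, mul_pow, mul_pow, mul_assoc]
    _ ≤ (B / H) ^ n * ((Real.exp 1 ^ n * n.factorial) * Real.exp (A * H / B)) := by gcongr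
    _ = _ := by
        rw [div_pow, div_pow, mul_pow]
        field_simp

/-- The size condition under which `∑ g_n(y) s^n / n!` converges for `y ∈ U` and `|s| < ρ`. -/
def FactorialBound (g : ℕ → ℂ → ℂ) (C ρ : ℝ) (U : Set ℂ) : Prop :=
  ∀ n, ∀ y ∈ U, ‖g n y‖ ≤ C * (n.factorial : ℝ) / ρ ^ n

theorem factorialBound_of_nested {g : ℕ → ℂ → ℂ} {K : ℝ → Set ℂ} {A B H : ℝ} (hA : 0 ≤ A)
    (hB : 0 < B) (hH : 0 < H) (hg0 : ∀ x, ‖g 0 x‖ ≤ 1)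
    (step : ∀ n t h M, 0 ≤ t → 0 < h → t + h ≤ H → (∀ x ∈ K t, ‖g n x‖ ≤ M) →
      ∀ x ∈ K (t + h), ‖g (n + 1) x‖ ≤ (A + B / h) * M) :
    FactorialBound g (Real.exp (A * H / B)) (H / (B * Real.exp 1)) (K H) := fun n y hy =>
  (norm_le_pow_of_nested hH hg0 step n y hy).trans (add_mul_div_pow_le hA hB hH n)

theorem norm_iterCoeff_succ_le {α β : ℂ → ℂ} {A B a M : ℝ} {n : ℕ} {x : ℂ} (hα : ‖α x‖ ≤ A)
    (hβ : ‖β x‖ ≤ B) (hM : ‖iterCoeff α β n x‖ ≤ M)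
    (hd : ‖x‖ * ‖deriv (iterCoeff α β n) x‖ ≤ a * M) :
    ‖iterCoeff α β (n + 1) x‖ ≤ (A + B * a) * M := by
  have hA : 0 ≤ A := (norm_nonneg _).trans hα
  have hB : 0 ≤ B := (norm_nonneg _).trans hβ
  calc ‖iterCoeff α β (n + 1) x‖
      ≤ ‖α x * iterCoeff α β n x‖ + ‖x * β x * deriv (iterCoeff α β n) x‖ := norm_add_le _ _
    _ = ‖α x‖ * ‖iterCoeff α β n x‖ + ‖β x‖ * (‖x‖ * ‖deriv (iterCoeff α β n) x‖) := by
        simp only [norm_mul]; ring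
    _ ≤ A * M + B * (a * M) := by gcongr
    _ = _ := by ring

theorem exists_pos_norm_le_of_isCompact {O : Set ℂ} {f : ℂ → ℂ}
    (hf : ContinuousOn f O) {K : Set ℂ} (hK : IsCompact K) (hKO : K ⊆ O) :
    ∃ A, 0 < A ∧ ∀ x ∈ K, ‖f x‖ ≤ A := by
  obtain ⟨A, hA⟩ := hK.exists_bound_of_continuousOn (hf.mono hKO)
  exact ⟨max A 1, by positivity, fun x hx => (hA x hx).trans (le_max_left _ _)⟩

/-- Cauchy estimates on shrinking concentric discs. -/
theorem exists_factorialBound {O : Set ℂ} (hO : IsOpen O) {α β : ℂ → ℂ}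
    (hα : DifferentiableOn ℂ α O) (hβ : DifferentiableOn ℂ β O) {ξ : ℂ} (hξ : ξ ∈ O) :
    ∃ C ρ δ : ℝ, 0 < ρ ∧ 0 < δ ∧ ball ξ δ ⊆ O ∧
      FactorialBound (iterCoeff α β) C ρ (ball ξ δ) := by
  obtain ⟨r, hr, hrO⟩ := nhds_basis_closedBall.mem_iff.1 (hO.mem_nhds hξ)
  obtain ⟨A, hA, hαA⟩ := exists_pos_norm_le_of_isCompact hα.continuousOn
    (isCompact_closedBall ξ r) hrO
  obtain ⟨B, hB, hβB⟩ := exists_pos_norm_le_of_isCompact hβ.continuousOn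
    (isCompact_closedBall ξ r) hrO
  have hR : ∀ x ∈ closedBall ξ r, ‖x‖ ≤ ‖ξ‖ + r := fun x hx => by
    have := norm_le_norm_add_norm_sub' x ξ
    rw [mem_closedBall, dist_eq_norm] at hx
    linarith
  have key := factorialBound_of_nested (g := iterCoeff α β) (K := fun t => closedBall ξ (r - t))
    (A := A) (B := B * (‖ξ‖ + r)) (H := r / 2) hA.le (by positivity) (by positivity)
    (fun x => by simp [iterCoeff]) (by
      intro n t h M ht hh htH hM x hx
      have hsub : closedBall x h ⊆ closedBall ξ (r - t) := by
        refine closedBall_subset_closedBall' ?_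
        have := mem_closedBall.1 hx
        linarith
      have hsub' : closedBall ξ (r - t) ⊆ closedBall ξ r := closedBall_subset_closedBall (by linarith)
      have hxr := hsub' (hsub (mem_closedBall_self hh.le))
      have hd := norm_deriv_le_of_closedBall hh
        ((differentiableOn_iterCoeff hO hα hβ n).mono (hsub.trans (hsub'.trans hrO)))
        fun z hz => hM z (hsub hz)
      have hMx := hM x (hsub (mem_closedBall_self hh.le))
      have := norm_iterCoeff_succ_le (a := (‖ξ‖ + r) / h) (hαA x hxr) (hβB x hxr) hMx (by
        calc ‖x‖ * ‖deriv (iterCoeff α β n) x‖ ≤ (‖ξ‖ + r) * (M / h) := by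
              gcongr
              exact hR x hxr
          _ = _ := by ring)
      rwa [mul_div_assoc])
  refine ⟨_, _, r / 2, ?_, by positivity, ?_, fun n y hy => key n y ?_⟩
  · positivity
  · exact (ball_subset_ball (by linarith)).trans (ball_subset_closedBall.trans hrO)
  · exact ball_subset_closedBall.trans (closedBall_subset_closedBall (by linarith)) hy

/-- At the origin the field `x β d/dx` vanishes, and discs shrinking geometrically give a bound
with arbitrarily large `ρ`. -/
theorem exists_factorialBound_zero {O : Set ℂ} (hO : IsOpen O) {α β : ℂ → ℂ}
    (hα : DifferentiableOn ℂ α O) (hβ : DifferentiableOn ℂ β O) (h0 : (0 : ℂ) ∈ O) {ρ : ℝ}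
    (hρ : 0 < ρ) :
    ∃ C δ : ℝ, 0 < δ ∧ ball 0 δ ⊆ O ∧ FactorialBound (iterCoeff α β) C ρ (ball 0 δ) := by
  obtain ⟨r, hr, hrO⟩ := nhds_basis_closedBall.mem_iff.1 (hO.mem_nhds h0)
  obtain ⟨A, hA, hαA⟩ := exists_pos_norm_le_of_isCompact hα.continuousOn
    (isCompact_closedBall 0 r) hrO
  obtain ⟨B, hB, hβB⟩ := exists_pos_norm_le_of_isCompact hβ.continuousOn
    (isCompact_closedBall 0 r) hrO
  set H := ρ * (B * Real.exp 1) with hHdef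
  have hH : 0 < H := by positivity
  have key := factorialBound_of_nested (g := iterCoeff α β)
    (K := fun t => closedBall 0 (r * Real.exp (-t)))
    (A := A) (B := B) (H := H) hA.le hB hH
    (fun x => by simp [iterCoeff]) (by
      intro n t h M ht hh htH hM x hx
      have hle : ‖x‖ ≤ r * Real.exp (-(t + h)) := by simpa using hx
      set d := r * Real.exp (-t) - r * Real.exp (-(t + h)) with hd_def
      have hdh : r * Real.exp (-(t + h)) * h ≤ d := by
        have h1 : Real.exp (-t) = Real.exp (-(t + h)) * Real.exp h := by
          rw [← Real.exp_add]; congr 1; ring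
        have h2 := Real.add_one_le_exp h
        have h3 : 0 < r * Real.exp (-(t + h)) := by positivity
        rw [hd_def, h1]
        nlinarith
      have hd : 0 < d := lt_of_lt_of_le (by positivity) hdh
      have hsub : closedBall x d ⊆ closedBall 0 (r * Real.exp (-t)) := by
        refine closedBall_subset_closedBall' ?_
        rw [dist_zero_right]
        linarith
      have hsub' : closedBall (0 : ℂ) (r * Real.exp (-t)) ⊆ closedBall 0 r := by
        refine closedBall_subset_closedBall ?_
        have : Real.exp (-t) ≤ 1 := Real.exp_le_one_iff.2 (by linarith)
        nlinarith
      have hxr := hsub' (hsub (mem_closedBall_self hd.le))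
      have hdv := norm_deriv_le_of_closedBall hd
        ((differentiableOn_iterCoeff hO hα hβ n).mono (hsub.trans (hsub'.trans hrO)))
        fun z hz => hM z (hsub hz)
      have hMx := hM x (hsub (mem_closedBall_self hd.le))
      have hM0 : 0 ≤ M := (norm_nonneg _).trans hMx
      have := norm_iterCoeff_succ_le (a := 1 / h) (hαA x hxr) (hβB x hxr) hMx (by
        calc ‖x‖ * ‖deriv (iterCoeff α β n) x‖ ≤ (d / h) * (M / d) := by
              gcongr
              rw [le_div_iff₀ hh]
              exact (mul_le_mul_of_nonneg_right hle hh.le).trans hdh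
          _ = 1 / h * M := by field_simp)
      rwa [mul_one_div] at this)
  rw [show H / (B * Real.exp 1) = ρ by rw [hHdef]; field_simp] at key
  refine ⟨_, r * Real.exp (-H), by positivity, ?_, fun n y hy =>
    key n y (ball_subset_closedBall hy)⟩
  refine (ball_subset_ball ?_).trans (ball_subset_closedBall.trans hrO)
  have : Real.exp (-H) ≤ 1 := Real.exp_le_one_iff.2 (by linarith)
  nlinarith

/-- The sum of the exponential generating series `∑ g_n(x) s^n / n!`. -/
noncomputable def expSum (g : ℕ → ℂ → ℂ) (p : ℂ × ℂ) : ℂ :=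
  ∑' n : ℕ, g n p.1 * (p.2 ^ n / (n.factorial : ℂ))

/-- The points near which `∑ g_n(x) s^n / n!` is dominated by a geometric series, uniformly
in `x`. -/
def expDomain (g : ℕ → ℂ → ℂ) (O : Set ℂ) : Set (ℂ × ℂ) :=
  {p | ∃ C ρ δ : ℝ, 0 < δ ∧ ball p.1 δ ⊆ O ∧ ‖p.2‖ < ρ ∧ FactorialBound g C ρ (ball p.1 δ)}

section

variable {g : ℕ → ℂ → ℂ} {O : Set ℂ} {C ρ δ : ℝ}

theorem FactorialBound.mono {U U' : Set ℂ} (h : FactorialBound g C ρ U) (hU : U' ⊆ U) :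
    FactorialBound g C ρ U' := fun n y hy => h n y (hU hy)

theorem FactorialBound.nonneg {U : Set ℂ} (h : FactorialBound g C ρ U) (hU : U.Nonempty) :
    0 ≤ C := by
  obtain ⟨y, hy⟩ := hU
  simpa using (norm_nonneg _).trans (h 0 y hy)

theorem isOpen_expDomain : IsOpen (expDomain g O) := by
  rw [isOpen_iff_mem_nhds]
  rintro ⟨x, s⟩ ⟨C, ρ, δ, hδ, hO, hs, hb⟩
  have hmem : ball x (δ / 2) ×ˢ ball (0 : ℂ) ρ ∈ nhds (x, s) :=
    prod_mem_nhds (ball_mem_nhds x (by positivity)) (isOpen_ball.mem_nhds (by simpa using hs))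
  filter_upwards [hmem]
  rintro ⟨y, t⟩ ⟨hy, ht⟩
  have hsub : ball y (δ / 2) ⊆ ball x δ := by
    refine ball_subset_ball' ?_
    have := mem_ball.1 hy
    dsimp at this
    linarith
  exact ⟨C, ρ, δ / 2, by positivity, hsub.trans hO, by simpa using ht, hb.mono hsub⟩

theorem fst_mem_of_mem_expDomain {p : ℂ × ℂ} (hp : p ∈ expDomain g O) : p.1 ∈ O := by
  obtain ⟨C, ρ, δ, hδ, hO, -⟩ := hp
  exact hO (mem_ball_self hδ)

theorem mk_mem_expDomain_of_norm_le {x s t : ℂ} (hp : (x, s) ∈ expDomain g O)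
    (ht : ‖t‖ ≤ ‖s‖) : (x, t) ∈ expDomain g O := by
  obtain ⟨C, ρ, δ, hδ, hO, hs, hb⟩ := hp
  exact ⟨C, ρ, δ, hδ, hO, ht.trans_lt hs, hb⟩

/-- The domain is a union of discs `{x} × {|t| ≤ |s|}` attached to `O × {0}`. -/
theorem isConnected_expDomain (hO : IsConnected O) (hsub : O ×ˢ {(0 : ℂ)} ⊆ expDomain g O) :
    IsConnected (expDomain g O) := by
  obtain ⟨⟨x₀, hx₀⟩, hpre⟩ := hO
  refine ⟨⟨(x₀, 0), hsub ⟨hx₀, rfl⟩⟩, isPreconnected_of_forall (x₀, 0) ?_⟩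
  rintro ⟨x, s⟩ hp
  refine ⟨O ×ˢ {(0 : ℂ)} ∪ {x} ×ˢ closedBall 0 ‖s‖, ?_, Or.inl ⟨hx₀, rfl⟩,
    Or.inr ⟨rfl, by simp⟩, ?_⟩
  · rintro ⟨y, t⟩ (h | ⟨hy, ht⟩)
    · exact hsub h
    · obtain rfl : y = x := hy
      exact mk_mem_expDomain_of_norm_le hp (by simpa using ht)
  · exact IsPreconnected.union (x, 0) ⟨fst_mem_of_mem_expDomain (p := (x, s)) hp, rfl⟩ ⟨rfl, by simp⟩
      (hpre.prod isPreconnected_singleton)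
      (isPreconnected_singleton.prod (convex_closedBall _ _).isPreconnected)

theorem FactorialBound.summable_expSum {U : Set ℂ} (hb : FactorialBound g C ρ U) {x s : ℂ}
    (hx : x ∈ U) (hs : ‖s‖ < ρ) :
    Summable fun n : ℕ => g n x * (s ^ n / (n.factorial : ℂ)) := by
  have hρ : 0 < ρ := (norm_nonneg s).trans_lt hs
  refine Summable.of_norm_bounded ((summable_geometric_of_lt_one (r := ‖s‖ / ρ) (by positivity)
    ((div_lt_one hρ).2 hs)).mul_left C) fun n => ?_
  rw [norm_mul, norm_div, norm_pow, Complex.norm_natCast]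
  calc ‖g n x‖ * (‖s‖ ^ n / n.factorial)
      ≤ (C * n.factorial / ρ ^ n) * (‖s‖ ^ n / n.factorial) := by
        gcongr
        exact hb n x hx
    _ = C * (‖s‖ / ρ) ^ n := by
        rw [div_pow]
        field_simp

/-- Expanding each `g_n` in its Taylor series turns `∑ g_n(x + ξ) s^n / n!` into an absolutely
convergent double series. -/
theorem FactorialBound.hasSum_prod {ξ x s : ℂ} (hb : FactorialBound g C ρ (ball ξ δ))
    (hg : ∀ n, DifferentiableOn ℂ (g n) (ball ξ δ)) (hx : ‖x‖ < δ) (hs : ‖s‖ < ρ) :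
    HasSum (fun p : ℕ × ℕ => PowerSeries.coeff p.2 (taylorAt (g p.1) ξ) * x ^ p.2 *
      (s ^ p.1 / (p.1.factorial : ℂ))) (expSum g (x + ξ, s)) := by
  have hρ : 0 < ρ := (norm_nonneg s).trans_lt hs
  obtain ⟨d, hxd, hdδ⟩ := exists_between hx
  have hd : 0 < d := (norm_nonneg x).trans_lt hxd
  have hsub : closedBall ξ d ⊆ ball ξ δ := closedBall_subset_ball hdδ
  have hC : 0 ≤ C := hb.nonneg ⟨ξ, mem_ball_self (hd.trans hdδ)⟩
  have hcoeff : ∀ n k, ‖PowerSeries.coeff k (taylorAt (g n) ξ)‖ ≤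
      C * n.factorial / ρ ^ n / d ^ k := by
    intro n k
    have := Complex.norm_iteratedDeriv_le_of_forall_mem_sphere_norm_le k hd
      (((hg n).mono hsub).diffContOnCl_ball subset_rfl)
      fun z hz => hb n z (hsub (sphere_subset_closedBall hz))
    simp only [taylorAt, PowerSeries.coeff_mk]
    rw [norm_div, Complex.norm_natCast, div_le_iff₀ (by positivity)]
    exact this.trans_eq (by ring)
  have hsum : Summable fun p : ℕ × ℕ => PowerSeries.coeff p.2 (taylorAt (g p.1) ξ) * x ^ p.2 *
      (s ^ p.1 / (p.1.factorial : ℂ)) := by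
    have h1 : Summable fun n : ℕ => C * (‖s‖ / ρ) ^ n :=
      (summable_geometric_of_lt_one (by positivity) ((div_lt_one hρ).2 hs)).mul_left C
    have h2 : Summable fun k : ℕ => (‖x‖ / d) ^ k :=
      summable_geometric_of_lt_one (by positivity) ((div_lt_one hd).2 hxd)
    refine Summable.of_norm_bounded (h1.mul_of_nonneg h2 (fun n => by positivity)
      fun k => by positivity) ?_
    rintro ⟨n, k⟩
    rw [norm_mul, norm_mul, norm_div, norm_pow, norm_pow, Complex.norm_natCast]
    calc _ ≤ C * n.factorial / ρ ^ n / d ^ k * ‖x‖ ^ k * (‖s‖ ^ n / n.factorial) := by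
          gcongr
          exact hcoeff n k
      _ = C * (‖s‖ / ρ) ^ n * (‖x‖ / d) ^ k := by
          rw [div_pow, div_pow]
          field_simp
  have hfib : ∀ n, HasSum (fun k => PowerSeries.coeff k (taylorAt (g n) ξ) * x ^ k *
      (s ^ n / (n.factorial : ℂ))) (g n (x + ξ) * (s ^ n / (n.factorial : ℂ))) := by
    intro n
    have hmem : x + ξ ∈ ball ξ δ := by simpa using hx
    refine HasSum.mul_right _ ?_
    have := Complex.hasSum_taylorSeries_on_ball (hg n) hmem
    convert! this using 1
    ext k
    simp only [taylorAt, PowerSeries.coeff_mk, add_sub_cancel_right, smul_eq_mul]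
    ring
  have h := hsum.hasSum.prod_fiberwise hfib
  rw [expSum, h.tsum_eq]
  exact hsum.hasSum

theorem FactorialBound.differentiableAt_expSum {x s : ℂ}
    (hb : FactorialBound g C ρ (ball x δ)) (hδ : 0 < δ)
    (hg : ∀ n, DifferentiableOn ℂ (g n) (ball x δ)) (hs : ‖s‖ < ρ) :
    DifferentiableAt ℂ (expSum g) (x, s) := by
  obtain ⟨σ, hsσ, hσρ⟩ := exists_between hs
  have hσ : 0 < σ := (norm_nonneg s).trans_lt hsσ
  have hρ : 0 < ρ := hσ.trans hσρ
  have hC : 0 ≤ C := hb.nonneg ⟨x, mem_ball_self hδ⟩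
  set q := σ / ρ with hq
  have hq0 : 0 < q := by positivity
  have hq1 : q < 1 := (div_lt_one hρ).2 hσρ
  set W : Set (ℂ × ℂ) := ball x (δ / 2) ×ˢ ball (0 : ℂ) σ with hW
  have hWo : IsOpen W := isOpen_ball.prod isOpen_ball
  have hWc : IsPreconnected W :=
    (convex_ball _ _).isPreconnected.prod (convex_ball _ _).isPreconnected
  have hxs : (x, s) ∈ W := ⟨mem_ball_self (by positivity), by simpa using hsσ⟩
  let f' : ℕ → ℂ × ℂ → (ℂ × ℂ →L[ℂ] ℂ) := fun n p =>
    g n p.1 • ((n * p.2 ^ (n - 1) / (n.factorial : ℂ)) • ContinuousLinearMap.snd ℂ ℂ ℂ) +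
      (p.2 ^ n / (n.factorial : ℂ)) • (deriv (g n) p.1 • ContinuousLinearMap.fst ℂ ℂ ℂ)
  have hsubW : ∀ {y}, y ∈ ball x (δ / 2) → closedBall y (δ / 4) ⊆ ball x δ := fun {y} hy => by
    intro z hz
    rw [mem_ball] at *
    rw [mem_closedBall] at hz
    linarith [dist_triangle z y x]
  have hder : ∀ n, ∀ p ∈ W,
      HasFDerivAt (fun p : ℂ × ℂ => g n p.1 * (p.2 ^ n / (n.factorial : ℂ))) (f' n p) p := by
    rintro n ⟨y, t⟩ ⟨hy, ht⟩
    have hyδ : y ∈ ball x δ := hsubW hy (mem_closedBall_self (by positivity))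
    have h1 : HasDerivAt (g n) (deriv (g n) y) y :=
      ((hg n).differentiableAt (isOpen_ball.mem_nhds hyδ)).hasDerivAt
    have h2 : HasDerivAt (fun t : ℂ => t ^ n / (n.factorial : ℂ))
        (n * t ^ (n - 1) / (n.factorial : ℂ)) t := (hasDerivAt_pow n t).div_const _
    have h1' := h1.comp_hasFDerivAt (y, t) (hasFDerivAt_fst (𝕜 := ℂ) (E := ℂ) (F := ℂ))
    have h2' := h2.comp_hasFDerivAt (y, t) (hasFDerivAt_snd (𝕜 := ℂ) (E := ℂ) (F := ℂ))
    exact h1'.mul h2'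
  let u : ℕ → ℝ := fun n => C / σ * (n * q ^ n) + C / (δ / 4) * q ^ n
  have hu : Summable u := by
    refine Summable.add (Summable.mul_left _ ?_) (Summable.mul_left _ ?_)
    · simpa using summable_pow_mul_geometric_of_norm_lt_one 1
        (r := q) (by rwa [Real.norm_of_nonneg hq0.le])
    · exact summable_geometric_of_lt_one hq0.le hq1
  have hbd : ∀ n, ∀ p ∈ W, ‖f' n p‖ ≤ u n := by
    rintro n ⟨y, t⟩ ⟨hy, ht⟩
    have hyδ : y ∈ ball x δ := hsubW hy (mem_closedBall_self (by positivity))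
    have ht' : ‖t‖ ≤ σ := by simpa using (mem_ball_zero_iff.1 ht).le
    have hgn := hb n y hyδ
    have hdn : ‖deriv (g n) y‖ ≤ C * n.factorial / ρ ^ n / (δ / 4) :=
      norm_deriv_le_of_closedBall (by positivity) ((hg n).mono (hsubW hy))
        fun z hz => hb n z (hsubW hy hz)
    have hσn : (n : ℝ) * σ ^ (n - 1) = n * σ ^ n / σ := by
      rcases n with _ | n
      · simp
      · rw [Nat.add_sub_cancel, pow_succ]
        field_simp
    refine (norm_add_le _ _).trans (add_le_add ?_ ?_)
    · rw [norm_smul, norm_smul, norm_div, norm_mul, norm_pow, Complex.norm_natCast,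
        Complex.norm_natCast]
      calc _ ≤ C * n.factorial / ρ ^ n * (n * σ ^ (n - 1) / n.factorial * 1) := by
            gcongr
            exact ContinuousLinearMap.norm_snd_le ℂ ℂ ℂ
        _ = _ := by
            rw [hσn, hq, div_pow]
            field_simp
    · rw [norm_smul, norm_smul, norm_div, norm_pow, Complex.norm_natCast]
      calc _ ≤ σ ^ n / n.factorial * (C * n.factorial / ρ ^ n / (δ / 4) * 1) := by
            gcongr
            exact ContinuousLinearMap.norm_fst_le ℂ ℂ ℂ
        _ = _ := by
            rw [hq, div_pow]
            field_simp
  exact (hasFDerivAt_tsum_of_isPreconnected hu hWo hWc hder hbd hxs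
    (hb.summable_expSum (mem_ball_self hδ) hs) hxs).differentiableAt

end

end InterpolationGroup

theorem mainTheorem7 (O : Set ℂ) (hO : IsOpen O) (hOconn : IsConnected O) (h0 : (0 : ℂ) ∈ O)
    (α β : ℂ → ℂ) (hα : DifferentiableOn ℂ α O) (hβ : DifferentiableOn ℂ β O) :
    ∃ (V : Set (ℂ × ℂ)) (F : ℂ × ℂ → ℂ),
      IsOpen V ∧ IsConnected V ∧
      O ×ˢ {(0 : ℂ)} ⊆ V ∧ {(0 : ℂ)} ×ˢ Set.univ ⊆ V ∧
      DifferentiableOn ℂ F V ∧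
      (∀ s : ℂ, ∃ r : ℝ, 0 < r ∧ ∀ x : ℂ, ‖x‖ < r →
        HasSum (fun n : ℕ =>
          PowerSeries.coeff n (InterpolationGroup.Exp
            (s • InterpolationGroup.taylorAt α 0) (s • InterpolationGroup.taylorAt β 0)) * x ^ n)
          (F (x, s))) ∧
      (∀ ξ ∈ O, ∃ r : ℝ, 0 < r ∧ ∀ x s : ℂ, ‖x‖ < r → ‖s‖ < r →
        HasSum (fun p : ℕ × ℕ =>
          PowerSeries.coeff p.2 (InterpolationGroup.localCoeff α β ξ p.1) * x ^ p.2 *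
            (s ^ p.1 / (p.1.factorial : ℂ)))
          (F (x + ξ, s))) := by
  open InterpolationGroup Metric in
  have hg := differentiableOn_iterCoeff hO hα hβ
  have hsub : O ×ˢ {(0 : ℂ)} ⊆ expDomain (iterCoeff α β) O := by
    rintro ⟨x, s⟩ ⟨hx, hs⟩
    obtain rfl : s = 0 := hs
    obtain ⟨C, ρ, δ, hρ, hδ, hδO, hb⟩ := exists_factorialBound hO hα hβ hx
    exact ⟨C, ρ, δ, hδ, hδO, by simpa using hρ, hb⟩
  refine ⟨expDomain (iterCoeff α β) O, expSum (iterCoeff α β), isOpen_expDomain,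
    isConnected_expDomain hOconn hsub, hsub, ?_, ?_, ?_, ?_⟩
  · rintro ⟨x, s⟩ ⟨hx, -⟩
    obtain rfl : x = 0 := hx
    obtain ⟨C, δ, hδ, hδO, hb⟩ := exists_factorialBound_zero hO hα hβ h0
      (ρ := ‖s‖ + 1) (by positivity)
    exact ⟨C, ‖s‖ + 1, δ, hδ, hδO, lt_add_one _, hb⟩
  · rintro ⟨x, s⟩ ⟨C, ρ, δ, hδ, hδO, hs, hb⟩
    exact (hb.differentiableAt_expSum hδ (fun n => (hg n).mono hδO) hs).differentiableWithinAt
  · intro s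
    obtain ⟨C, δ, hδ, hδO, hb⟩ := exists_factorialBound_zero hO hα hβ h0
      (ρ := ‖s‖ + 1) (by positivity)
    refine ⟨δ, hδ, fun x hx => ?_⟩
    have h := hb.hasSum_prod (fun n => (hg n).mono hδO) hx (lt_add_one ‖s‖)
    simp only [taylorAt_iterCoeff hO hα hβ h0, add_zero] at h
    have h' := (Equiv.prodComm ℕ ℕ).hasSum_iff.2 h
    refine h'.prod_fiberwise fun k => ?_
    rw [coeff_Exp_smul, ← tsum_mul_right,
      tsum_congr fun n : ℕ => mul_right_comm _ (s ^ n / (n.factorial : ℂ)) (x ^ k)]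
    exact (h'.summable.prod_factor k).hasSum
  · intro ξ hξ
    obtain ⟨C, ρ, δ, hρ, hδ, hδO, hb⟩ := exists_factorialBound hO hα hβ hξ
    refine ⟨min δ ρ, lt_min hδ hρ, fun x s hx hs => ?_⟩
    have h := hb.hasSum_prod (fun n => (hg n).mono hδO) (hx.trans_le (min_le_left _ _))
      (hs.trans_le (min_le_right _ _))
    simpa only [taylorAt_iterCoeff hO hα hβ hξ] using h
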